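/- Let $K,N\ge 2$ be integers. In the $(K,N,M)$ device-to-device private caching system with a trusted server, where $M\in[N/K,N]$, the library consists of $N$ independent files $F_1,\dots,F_N$, each of $B$ i.i.d. uniform bits, and there are $K$ users with demand vector $\mathbf D=(D_1,\dots,D_K)\in[N]^K$, independent of the library. A scheme consists of the following, all variables having finite alphabets. - Placement: random cache metadata $(\mathscr M(C_1),\dots,\mathscr M(C_K))$, independent of the library and of the demands, and caches $Z_k=(\mathscr M(C_k),C_k)$, where $C_k$ is a deterministic function of $\mathscr M(C_k)$ and $F_1,\dots,F_N$. - Delivery: the trusted server, which has no access to the library, draws queries $(\mathscr M(P_1),\dots,\mathscr M(P_K))$ at random with a law that depends only on $\mathbf D$ and the cache metadata; user $k$ then broadcasts $X_k=(\mathscr M(P_k),P_k)$, where $P_k$ is a deterministic function of $\mathscr M(P_k)$ and $Z_k$. Write $\mathbf X=(X_1,\dots,X_K)$. A load $R$ is achievable with memory $M$ if there are $\epsilon_B\ge 0$ with $\epsilon_B\to 0$ as $B\to\infty$ such that for every sufficiently large $B$ there is a scheme for which, for every law of the demand vector $\mathbf D$ and with entropies in bits, $$H(Z_k)\le B(M+\epsilon_B),\qquad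 H(F_{D_k}\mid \mathbf X,Z_k,D_k)\le B\epsilon_B,\qquad I(\mathbf D;\mathbf X,Z_k\mid D_k)=0\qquad\text{for all }k\in[K],$$ $$\sum_{k\in[K]}H(X_k)\le B(R+\epsilon_B).$$ Let $R^\star=R^\star(M)$ be the infimum of the achievable loads, and let $U=(K-1)N$. **Theorem.** For every $M\in[N/K,N]$, the value at $M$ of the lower convex envelope of the points $$\left(\frac{N+t-1}{K},\ \frac{\binom Ut-\binom{U-N}t}{\binom U{t-1}}\right),\qquad t\in\{1,\dots,U+1\},$$ is an achievable load; in particular $R^\star$ is at most this value. -/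

import Mathlib

open Filter Topology

noncomputable section

namespace D2DCaching

/-! ### Shannon information measures (in bits) of finitely-valued random variables -/

/-- Shannon entropy `H(X)` in bits of the finitely-valued random variable `X` on `(Ω, P)`. -/
def entropy {Ω α : Type} [Fintype α] (P : PMF Ω) (X : Ω → α) : ℝ :=
  ∑ a, Real.negMulLog ((P.map X) a).toReal / Real.log 2

/-- Conditional entropy `H(X | Y) = H(X, Y) - H(Y)`. -/
def condEntropy {Ω α β : Type} [Fintype α] [Fintype β]
    (P : PMF Ω) (X : Ω → α) (Y : Ω → β) : ℝ :=
  entropy P (fun ω => (X ω, Y ω)) - entropy P Y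

/-- Conditional mutual information `I(X ; Y | Z) = H(X | Z) - H(X | Y, Z)`. -/
def condMutualInfo {Ω α β γ : Type} [Fintype α] [Fintype β] [Fintype γ]
    (P : PMF Ω) (X : Ω → α) (Y : Ω → β) (Z : Ω → γ) : ℝ :=
  condEntropy P X Z - condEntropy P X (fun ω => (Y ω, Z ω))

/-! ### Device-to-device private caching with a trusted server -/

/-- A library of `N` files of `B` bits each. -/
abbrev Library (N B : ℕ) : Type := Fin N → Fin B → Bool

/-- A demand vector: user `k` demands the file with index `d k`. -/
abbrev Demands (K N : ℕ) : Type := Fin K → Fin N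

/-- A two-phase caching scheme with a trusted server, for `K` users and `N` files of `B` bits.

* The cache metadata `(𝓜(C_1), …, 𝓜(C_K))` is drawn from `placement`, without knowledge of the
  demands and independently of the library.
* `C_k` is a deterministic function of the metadata `𝓜(C_k)` and of the library.
* The trusted server, which knows the demands and all cache metadata but has no access to the
  library, draws the queries `(𝓜(P_1), …, 𝓜(P_K))` from `query`.
* `P_k` is a deterministic function of the query `𝓜(P_k)` and of `Z_k = (𝓜(C_k), C_k)`.

All alphabets are finite. -/
structure Scheme (K N B : ℕ) where
  CacheMeta : Fin K → Type
  CacheContent : Fin K → Type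
  PacketMeta : Fin K → Type
  Packet : Fin K → Type
  [fintypeCacheMeta : ∀ k, Fintype (CacheMeta k)]
  [fintypeCacheContent : ∀ k, Fintype (CacheContent k)]
  [fintypePacketMeta : ∀ k, Fintype (PacketMeta k)]
  [fintypePacket : ∀ k, Fintype (Packet k)]
  placement : PMF (∀ k, CacheMeta k)
  cache : ∀ k, CacheMeta k → Library N B → CacheContent k
  query : Demands K N → (∀ k, CacheMeta k) → PMF (∀ k, PacketMeta k)
  packet : ∀ k, PacketMeta k → CacheMeta k × CacheContent k → Packet k

attribute [instance] Scheme.fintypeCacheMeta Scheme.fintypeCacheContent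
  Scheme.fintypePacketMeta Scheme.fintypePacket

namespace Scheme

variable {K N B : ℕ}

/-- An outcome of the system: the demands, the library, the cache metadata and the queries. -/
structure Outcome (s : Scheme K N B) : Type where
  demand : Demands K N
  files : Library N B
  cacheMeta : ∀ k, s.CacheMeta k
  packetMeta : ∀ k, s.PacketMeta k

/-- The joint law when the demand vector has law `PD`: demands, files (i.i.d. uniform bits) and
cache metadata are independent, and the queries are drawn by the server given the demands and the
cache metadata. -/
def law (s : Scheme K N B) (PD : PMF (Demands K N)) : PMF s.Outcome :=
  PD.bind fun d =>
    (PMF.uniformOfFintype (Library N B)).bind fun F =>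
      s.placement.bind fun mc =>
        (s.query d mc).map fun mp => ⟨d, F, mc, mp⟩

/-- The cache `Z_k = (𝓜(C_k), C_k)` of user `k`. -/
def Z (s : Scheme K N B) (k : Fin K) (ω : s.Outcome) : s.CacheMeta k × s.CacheContent k :=
  (ω.cacheMeta k, s.cache k (ω.cacheMeta k) ω.files)

/-- The broadcast signal `X_k = (𝓜(P_k), P_k)` of user `k`. -/
def X (s : Scheme K N B) (k : Fin K) (ω : s.Outcome) : s.PacketMeta k × s.Packet k :=
  (ω.packetMeta k, s.packet k (ω.packetMeta k) (s.Z k ω))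

/-- All the broadcast signals `𝐗 = (X_1, …, X_K)`. -/
def allX (s : Scheme K N B) (ω : s.Outcome) : ∀ k, s.PacketMeta k × s.Packet k :=
  fun k => s.X k ω

/-- The cache size, decoding, privacy and load constraints for memory `M`, load `R` and slack `ε`,
when the demand vector has law `PD`. -/
structure Satisfies (s : Scheme K N B) (PD : PMF (Demands K N)) (M R ε : ℝ) : Prop where
  cacheSize : ∀ k, entropy (s.law PD) (s.Z k) ≤ B * (M + ε)
  decoding : ∀ k,
    condEntropy (s.law PD) (fun ω => ω.files (ω.demand k))
      (fun ω => (s.allX ω, s.Z k ω, ω.demand k)) ≤ B * ε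
  privacy : ∀ k,
    condMutualInfo (s.law PD) (fun ω => ω.demand) (fun ω => (s.allX ω, s.Z k ω))
      (fun ω => ω.demand k) = 0
  load : ∑ k, entropy (s.law PD) (s.X k) ≤ B * (R + ε)

end Scheme

/-- Load `R` is achievable with memory `M`: there are `ε_B ≥ 0` with `ε_B → 0` such that for all
large `B` some scheme meets all the constraints with slack `ε_B`. The scheme may not depend on the
law of the demand vector. -/
def Achievable (K N : ℕ) (M R : ℝ) : Prop :=
  ∃ ε : ℕ → ℝ, (∀ B, 0 ≤ ε B) ∧ Tendsto ε atTop (𝓝 0) ∧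
    ∀ᶠ B : ℕ in atTop, ∃ s : Scheme K N B,
      ∀ PD : PMF (Demands K N), s.Satisfies PD M R (ε B)

/-- The optimal load `R⋆` at memory `M`. -/
def optimalLoad (K N : ℕ) (M : ℝ) : ℝ := sInf {R : ℝ | Achievable K N M R}

/-- The number `U = (K - 1) N` of effective users. -/
def effectiveUsers (K N : ℕ) : ℕ := (K - 1) * N

/-- The memory-load pair with parameter `t` (for `K ≥ 2` one has `N ≤ U`). -/
def cornerPoint (K N t : ℕ) : ℝ × ℝ :=
  (((N : ℝ) + t - 1) / K,
    (((effectiveUsers K N).choose t : ℝ) - ((effectiveUsers K N - N).choose t : ℝ)) /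
      ((effectiveUsers K N).choose (t - 1) : ℝ))

/-- The memory-load pairs for `t = 1, …, U + 1`. -/
def cornerPoints (K N : ℕ) : Set (ℝ × ℝ) :=
  {p | ∃ t : ℕ, 1 ≤ t ∧ t ≤ effectiveUsers K N + 1 ∧ p = cornerPoint K N t}

/-- The lower convex envelope at abscissa `x` of a set of points of the plane: the lower boundary
of its convex hull. -/
def lowerConvexEnvelope (S : Set (ℝ × ℝ)) (x : ℝ) : ℝ :=
  sInf {y : ℝ | (x, y) ∈ convexHull ℝ S}

/-! ### The infimum defining the optimal load is over a set bounded below -/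

theorem entropy_nonneg {Ω α : Type} [Fintype α] (P : PMF Ω) (X : Ω → α) : 0 ≤ entropy P X := by
  refine Finset.sum_nonneg fun a _ => div_nonneg (Real.negMulLog_nonneg ENNReal.toReal_nonneg ?_)
    (Real.log_nonneg one_le_two)
  exact ENNReal.toReal_le_of_le_ofReal zero_le_one (by rw [ENNReal.ofReal_one]; exact PMF.coe_le_one _ a)

theorem Achievable.nonneg {K N : ℕ} (hN : 1 ≤ N) {M R : ℝ} (h : Achievable K N M R) : 0 ≤ R := by
  obtain ⟨ε, -, hlim, hev⟩ := h
  have hlim' : Tendsto (fun B => R + ε B) atTop (𝓝 (R + 0)) := hlim.const_add R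
  rw [add_zero] at hlim'
  refine ge_of_tendsto hlim' ?_
  filter_upwards [hev, eventually_gt_atTop 0] with B hB hB0
  obtain ⟨s, hs⟩ := hB
  have h1 := (hs (PMF.pure fun _ => ⟨0, hN⟩)).load
  have h2 : (0 : ℝ) ≤ B * (R + ε B) :=
    le_trans (Finset.sum_nonneg fun k _ => entropy_nonneg _ _) h1
  exact nonneg_of_mul_nonneg_right h2 (by exact_mod_cast hB0)

theorem bddBelow_achievable {K N : ℕ} (hN : 1 ≤ N) (M : ℝ) :
    BddBelow {R : ℝ | Achievable K N M R} :=
  ⟨0, fun _ h => h.nonneg hN⟩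

end D2DCaching

end

noncomputable section

namespace D2DCaching

/-! ### Entropy of finitely-valued random variables -/

/-! Write `K = n + 1` and `U = n * N`. Each file is cut into `K` shares, one per sender, and the
share of sender `j` is handled by a shared-link coded caching scheme for `U` effective users `(r,
i)`: one row per user other than `j`, one column per value of a secret in `Fin N`. The share is
split into subfiles indexed by sets `T` of effective users. User `k` with secret `s k` keeps its own
share and, in the other shares, acts as the effective user `(r, s k)` of its row. The server reveals
only `p = d - s`, and `(r, i)` demands the file `p + i` (`p` taken at the user of row `r`), so user
`k` obtains `p k + s k = d k` (`decodable`).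

Privacy: changing the demands of the others while shifting their secrets equally leaves `p`, the
messages and the cache of user `k` unchanged, and the secrets are uniform
(`condMutualInfo_demands_eq_zero`).

Load: every row demands each file exactly once, so any fixed row is a set of `N` leaders whatever
`p` is. By the parity relation `sum_multicast_sdiff_transversals`, messages for sets disjoint from
the leaders are redundant (`messages_eq_of_eq_on_leaders`). For `|T| = t` this leaves `C(U, t+1) -
C(U-N, t+1)` messages of relative size `1 / (K * C(U, t))` per sender, which is the corner point
with parameter `t + 1`.

Mixing set sizes within one scheme gives all convex combinations (`achievable_of_weights`); the
envelope value is one of them because the hull of finitely many points is compact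
(`lowerConvexEnvelope_mem`). -/

theorem entropy_map {Ω Ω' α : Type} [Fintype α] (P : PMF Ω) (f : Ω → Ω') (X : Ω' → α) :
    entropy (P.map f) X = entropy P (fun ω => X (f ω)) := by
  unfold entropy
  rw [PMF.map_comp]
  rfl

theorem entropy_eq_entropy_map_id {Ω α : Type} [Fintype α] (P : PMF Ω) (X : Ω → α) :
    entropy P X = entropy (P.map X) id := by
  rw [entropy_map]
  rfl

theorem sum_toReal_pmf {α : Type} [Fintype α] (P : PMF α) : ∑ a, (P a).toReal = 1 := by
  rw [← ENNReal.toReal_sum fun a _ => P.apply_ne_top a, ← tsum_fintype (L := .unconditional _),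
    P.tsum_coe, ENNReal.toReal_one]

theorem map_apply_of_injective {α β : Type} (P : PMF α) {f : α → β} (hf : Function.Injective f)
    (a : α) : (P.map f) (f a) = P a := by
  classical
  rw [PMF.map_apply, tsum_eq_single a]
  · simp
  · intro b hb
    rw [if_neg fun h => hb (hf h).symm]

theorem map_apply_of_notMem_range {α β : Type} (P : PMF α) {f : α → β} {b : β}
    (hb : b ∉ Set.range f) : (P.map f) b = 0 := by
  rw [PMF.apply_eq_zero_iff, PMF.support_map]
  rintro ⟨a, -, rfl⟩
  exact hb ⟨a, rfl⟩

/-- Entropy is invariant under relabelling by an injective map. -/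
theorem entropy_comp_of_injective {Ω α β : Type} [Fintype α] [Fintype β] (P : PMF Ω) (X : Ω → α)
    {f : α → β} (hf : Function.Injective f) : entropy P (fun ω => f (X ω)) = entropy P X := by
  unfold entropy
  have hmap : P.map (fun ω => f (X ω)) = (P.map X).map f := by rw [PMF.map_comp]; rfl
  rw [hmap]
  symm
  refine Fintype.sum_of_injective f hf _ _ ?_ ?_
  · intro b hb
    rw [map_apply_of_notMem_range _ hb]
    simp
  · intro a
    rw [map_apply_of_injective _ hf]

theorem exists_eq_comp_of_determined {Ω α β : Type} [Nonempty Ω] {X : Ω → α} {Y : Ω → β}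
    (h : ∀ ω ω', Y ω = Y ω' → X ω = X ω') : ∃ f : β → α, ∀ ω, X ω = f (Y ω) := by
  have hX : Function.FactorsThrough X Y := fun ω ω' hω => h ω ω' hω
  have : Nonempty α := Nonempty.map X ‹_›
  exact ⟨Function.extend Y X fun _ => Classical.arbitrary α, fun ω => (hX.extend_apply _ ω).symm⟩

theorem condEntropy_eq_zero_of_determined {Ω α β : Type} [Fintype α] [Fintype β] (P : PMF Ω)
    {X : Ω → α} {Y : Ω → β} (h : ∀ ω ω', Y ω = Y ω' → X ω = X ω') : condEntropy P X Y = 0 := by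
  have : Nonempty Ω := P.support_nonempty.to_type
  obtain ⟨f, hf⟩ := exists_eq_comp_of_determined h
  have hinj : Function.Injective fun y : β => (f y, y) := fun y y' hy => (Prod.ext_iff.1 hy).2
  have := entropy_comp_of_injective P Y hinj
  simp only [condEntropy, hf, this, sub_self]

/-- Entropy is at most the logarithm of the size of any finite set containing the range. -/
theorem entropy_le_logb_card_of_mem {Ω α : Type} [Fintype α] (P : PMF Ω) (X : Ω → α)
    (A : Finset α) (hA : ∀ ω, X ω ∈ A) : entropy P X ≤ Real.logb 2 A.card := by
  classical
  set p : α → ℝ := fun a => ((P.map X) a).toReal with hp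
  have hzero : ∀ a, a ∉ A → p a = 0 := by
    intro a ha
    have : (P.map X) a = 0 := map_apply_of_notMem_range _ (by rintro ⟨ω, rfl⟩; exact ha (hA ω))
    rw [hp]
    simp only [this, ENNReal.toReal_zero]
  have hsum : ∑ a ∈ A, p a = 1 := by
    rw [← sum_toReal_pmf (P.map X)]
    exact Finset.sum_subset (Finset.subset_univ _) fun a _ ha => hzero a ha
  have hpos : 0 < A.card := by
    rw [Finset.card_pos, Finset.nonempty_iff_ne_empty]
    rintro rfl
    simp at hsum
  have hcard : (0 : ℝ) < A.card := by exact_mod_cast hpos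
  -- Gibbs' inequality termwise: `log x ≤ x - 1` at `x = 1 / (p a * |A|)`. The correction terms sum
  -- to zero over `A`.
  have hterm : ∀ a, Real.negMulLog (p a) ≤
      p a * Real.log A.card + ((A.card : ℝ)⁻¹ - p a) := by
    intro a
    have hpa : 0 ≤ p a := ENNReal.toReal_nonneg
    rcases hpa.eq_or_lt with h0 | h0
    · rw [← h0]; simp
    · have hlog := Real.log_le_sub_one_of_pos (x := (p a * A.card)⁻¹) (by positivity)
      rw [Real.log_inv, Real.log_mul h0.ne' hcard.ne'] at hlog
      have := mul_le_mul_of_nonneg_left hlog hpa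
      have hx : p a * ((p a * A.card)⁻¹ - 1) = (A.card : ℝ)⁻¹ - p a := by field_simp
      rw [hx] at this
      rw [Real.negMulLog]
      linarith
  have hmain : ∑ a ∈ A, Real.negMulLog (p a) ≤ Real.log A.card := by
    calc ∑ a ∈ A, Real.negMulLog (p a)
        ≤ ∑ a ∈ A, (p a * Real.log A.card + ((A.card : ℝ)⁻¹ - p a)) :=
          Finset.sum_le_sum fun a _ => hterm a
      _ = Real.log A.card := by
          rw [Finset.sum_add_distrib, ← Finset.sum_mul, Finset.sum_sub_distrib, hsum]
          simp [hcard.ne']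
  have hent : entropy P X = (∑ a ∈ A, Real.negMulLog (p a)) / Real.log 2 := by
    rw [entropy, ← Finset.sum_div]
    congr 1
    exact (Finset.sum_subset (Finset.subset_univ _) fun a _ ha => by
      change Real.negMulLog (p a) = 0
      rw [hzero a ha]; simp).symm
  rw [hent, Real.logb]
  exact div_le_div_of_nonneg_right hmain (Real.log_nonneg one_le_two)

theorem entropy_le_logb_card_of_determined {Ω α β : Type} [Fintype α] [Fintype β] (P : PMF Ω)
    {X : Ω → α} (Y : Ω → β) (h : ∀ ω ω', Y ω = Y ω' → X ω = X ω') :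
    entropy P X ≤ Real.logb 2 (Fintype.card β) := by
  classical
  have : Nonempty Ω := P.support_nonempty.to_type
  obtain ⟨f, hf⟩ := exists_eq_comp_of_determined h
  have : Nonempty β := Nonempty.map Y ‹_›
  refine (entropy_le_logb_card_of_mem P X (Finset.univ.image f) fun ω => ?_).trans ?_
  · rw [hf]
    exact Finset.mem_image_of_mem _ (Finset.mem_univ _)
  · refine Real.logb_le_logb_of_le one_lt_two ?_ ?_
    · have : (Finset.univ.image f).Nonempty := Finset.univ_nonempty.image f
      exact_mod_cast this.card_pos
    · exact_mod_cast Finset.card_image_le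

/-- Chain rule for a variable drawn from a kernel. -/
theorem entropy_bind_map_mk {α β : Type} [Fintype α] [Fintype β] (P : PMF α) (κ : α → PMF β) :
    entropy (P.bind fun a => (κ a).map (Prod.mk a)) id =
      entropy P id + ∑ a, (P a).toReal * entropy (κ a) id := by
  classical
  have happ : ∀ a b, (P.bind fun a => (κ a).map (Prod.mk a)) (a, b) = P a * κ a b := by
    intro a b
    rw [PMF.bind_apply, tsum_eq_single a]
    · rw [map_apply_of_injective _ (Prod.mk_right_injective a)]
    · intro a' ha'
      rw [map_apply_of_notMem_range, mul_zero]
      rintro ⟨b', hb'⟩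
      exact ha' (Prod.ext_iff.1 hb').1
  simp only [entropy, PMF.map_id]
  rw [Fintype.sum_prod_type, ← Finset.sum_add_distrib]
  refine Finset.sum_congr rfl fun a _ => ?_
  simp only [happ, ENNReal.toReal_mul, Real.negMulLog_mul]
  rw [← Finset.sum_div, ← Finset.sum_div, Finset.sum_add_distrib, ← Finset.sum_mul,
    ← Finset.mul_sum, sum_toReal_pmf]
  ring

theorem sum_map_toReal_mul {α γ : Type} [Fintype α] [Fintype γ] (P : PMF α) (g : α → γ)
    (φ : γ → ℝ) : ∑ c, ((P.map g) c).toReal * φ c = ∑ a, (P a).toReal * φ (g a) := by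
  classical
  have : ∀ c, ((P.map g) c).toReal = ∑ a, if c = g a then (P a).toReal else 0 := by
    intro c
    rw [PMF.map_apply, tsum_fintype, ENNReal.toReal_sum]
    · exact Finset.sum_congr rfl fun a _ => by split_ifs <;> simp
    · intro a _
      split_ifs
      · exact P.apply_ne_top a
      · simp
  simp only [this, Finset.sum_mul]
  rw [Finset.sum_comm]
  refine Finset.sum_congr rfl fun a _ => ?_
  simp [ite_mul]

/-- If the conditional law of `Y` given `D` depends only on `g D`, then `I(D ; Y | g D) = 0`. -/
theorem condMutualInfo_eq_zero {Ω α β γ : Type} [Fintype α] [Fintype β] [Fintype γ]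
    (P : PMF Ω) (D : Ω → α) (Y : Ω → β) (g : α → γ) (Q : PMF α) (κ : γ → PMF β)
    (h : P.map (fun ω => (D ω, Y ω)) = Q.bind fun a => (κ (g a)).map (Prod.mk a)) :
    condMutualInfo P D Y (fun ω => g (D ω)) = 0 := by
  have hD : P.map D = Q := by
    have := congrArg (PMF.map Prod.fst) h
    rw [PMF.map_comp, PMF.map_bind] at this
    simp only [PMF.map_comp] at this
    have hconst : ∀ a : α, (Prod.fst ∘ Prod.mk a : β → α) = Function.const β a := fun a => rfl
    simp only [hconst, PMF.map_const, PMF.bind_pure] at this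
    exact this
  have hDg : entropy P (fun ω => (D ω, g (D ω))) = entropy Q id := by
    rw [entropy_comp_of_injective P D (f := fun a => (a, g a))
      fun a a' ha => (Prod.ext_iff.1 ha).1, entropy_eq_entropy_map_id, hD]
  have hDYg : entropy P (fun ω => (D ω, (Y ω, g (D ω)))) =
      entropy Q id + ∑ a, (Q a).toReal * entropy (κ (g a)) id := by
    rw [entropy_comp_of_injective P (fun ω => (D ω, Y ω)) (f := fun x => (x.1, (x.2, g x.1))),
      entropy_eq_entropy_map_id, h, entropy_bind_map_mk]
    rintro ⟨a, b⟩ ⟨a', b'⟩ hx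
    simp only [Prod.mk.injEq] at hx
    exact Prod.ext hx.1 hx.2.1
  have hg : entropy P (fun ω => g (D ω)) = entropy (Q.map g) id := by
    rw [entropy_eq_entropy_map_id, ← hD, PMF.map_comp]
    rfl
  have hYg : entropy P (fun ω => (Y ω, g (D ω))) =
      entropy (Q.map g) id + ∑ a, (Q a).toReal * entropy (κ (g a)) id := by
    rw [entropy_comp_of_injective P (fun ω => (g (D ω), Y ω)) (f := fun x => (x.2, x.1))
        Prod.swap_injective,
      entropy_eq_entropy_map_id, ← sum_map_toReal_mul Q g fun c => entropy (κ c) id,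
      ← entropy_bind_map_mk]
    congr 1
    have := congrArg (PMF.map (Prod.map g id)) h
    rw [PMF.map_comp, PMF.map_bind] at this
    rw [PMF.bind_map]
    simp only [PMF.map_comp] at this
    exact this
  -- The average entropy of the kernel is both `H(Y | D)` and `H(Y | g D)`, so it cancels.
  simp only [condMutualInfo, condEntropy, hDg, hDYg, hg, hYg]
  ring

theorem map_uniformOfFintype_equiv {α : Type} [Fintype α] [Nonempty α] (e : α ≃ α) :
    (PMF.uniformOfFintype α).map e = PMF.uniformOfFintype α := by
  ext a
  obtain ⟨b, rfl⟩ := e.surjective a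
  rw [map_apply_of_injective _ e.injective]
  simp

/-! ### Redundancy among the multicast messages -/

section Multicast

variable {V α R : Type} [DecidableEq V] [DecidableEq α]

/-- The multicast message for the set `S` of users: user `u` demands file `a u`, and `G i T` is the
subfile of file `i` stored exactly by the users in `T`. -/
def multicast [AddCommMonoid R] (a : V → α) (G : α → Finset V → R) (S : Finset V) : R :=
  ∑ u ∈ S, G (a u) (S.erase u)

variable [Fintype V] [Fintype α]

/-- The ways of choosing in `T`, for each file, a user demanding this file. -/
def transversals (a : V → α) (T : Finset V) : Finset (α → V) :=
  Finset.univ.filter fun φ => ∀ i, φ i ∈ T ∧ a (φ i) = i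

/-- In characteristic two, the messages for the complements of the transversals sum to zero. -/
theorem sum_multicast_sdiff_transversals [Ring R] [CharP R 2] (a : V → α)
    (G : α → Finset V → R) (T : Finset V) :
    ∑ φ ∈ transversals a T, multicast a G (T \ Finset.univ.image φ) = 0 := by
  unfold multicast
  rw [Finset.sum_sigma']
  -- Exchange `u` with the user `φ (a u)` chosen for the same file. Both demand that file, and
  -- removing either one leaves the same set, so the two terms agree and cancel; `u` is not in the
  -- image of `φ`, so there is no fixed point.
  refine Finset.sum_involution
    (fun x _ => ⟨Function.update x.1 (a x.2) x.2, x.1 (a x.2)⟩) ?_ ?_ ?_ ?_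
  · rintro ⟨φ, u⟩ hx
    simp only [Finset.mem_sigma, transversals, Finset.mem_filter, Finset.mem_univ, true_and,
      Finset.mem_sdiff, Finset.mem_image, not_exists] at hx
    obtain ⟨hφ, hu, hne⟩ := hx
    have hset : (T \ Finset.univ.image (Function.update φ (a u) u)).erase (φ (a u)) =
        (T \ Finset.univ.image φ).erase u := by
      ext v
      simp only [Finset.mem_erase, Finset.mem_sdiff, Finset.mem_image, Finset.mem_univ, true_and,
        not_exists]
      constructor
      · rintro ⟨h1, h2, h3⟩
        refine ⟨?_, h2, ?_⟩
        · rintro rfl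
          exact h3 (a v) (by simp)
        · intro i hi
          by_cases hia : i = a u
          · subst hia; exact h1 hi.symm
          · exact h3 i (by rw [Function.update_of_ne hia]; exact hi)
      · rintro ⟨h1, h2, h3⟩
        refine ⟨fun h => h3 _ h.symm, h2, ?_⟩
        intro i hi
        by_cases hia : i = a u
        · subst hia
          rw [Function.update_self] at hi
          exact h1 hi.symm
        · rw [Function.update_of_ne hia] at hi
          exact h3 i hi
    dsimp only
    rw [hset, (hφ (a u)).2]
    exact CharTwo.add_self_eq_zero _
  · rintro ⟨φ, u⟩ hx _ heq
    simp only [Finset.mem_sigma, Finset.mem_sdiff, Finset.mem_image, Finset.mem_univ, true_and,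
      not_exists] at hx
    simp only [Sigma.mk.injEq, heq_eq_eq] at heq
    exact hx.2.2 _ heq.2
  · rintro ⟨φ, u⟩ hx
    simp only [Finset.mem_sigma, transversals, Finset.mem_filter, Finset.mem_univ, true_and,
      Finset.mem_sdiff, Finset.mem_image, not_exists] at hx ⊢
    obtain ⟨hφ, hu, hne⟩ := hx
    refine ⟨fun i => ?_, (hφ _).1, fun i hi => ?_⟩
    · by_cases hia : i = a u
      · subst hia; simp [hu]
      · rw [Function.update_of_ne hia]; exact hφ i
    · by_cases hia : i = a u
      · subst hia
        rw [Function.update_self] at hi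
        exact hne _ hi.symm
      · rw [Function.update_of_ne hia] at hi
        have h1 := (hφ i).2
        rw [hi, (hφ (a u)).2] at h1
        exact hia h1.symm
  · rintro ⟨φ, u⟩ hx
    simp only [Finset.mem_sigma, transversals, Finset.mem_filter, Finset.mem_univ, true_and] at hx
    simp [(hx.1 (a u)).2]

/-- The messages for sets meeting a transversal `ldr` determine those of the other sets of the same
size. -/
theorem multicast_eq_of_eq_on_leaders [Ring R] [CharP R 2] (a : V → α) (ldr : α → V)
    (hldr : ∀ i, a (ldr i) = i) (G G' : α → Finset V → R) (S : Finset V)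
    (h : ∀ S' : Finset V, S'.card = S.card → ¬ Disjoint S' (Finset.univ.image ldr) →
      multicast a G S' = multicast a G' S') :
    multicast a G S = multicast a G' S := by
  by_cases hS : Disjoint S (Finset.univ.image ldr)
  swap
  · exact h S rfl hS
  -- In the parity relation for `T`, the transversal `ldr` contributes the message for `S`. Any
  -- other transversal omits some leader, so its complement in `T` meets the leaders; all
  -- complements have the size of `S`.
  set T := S ∪ Finset.univ.image ldr with hT
  have hmem : ldr ∈ transversals a T := by
    simp only [transversals, Finset.mem_filter, Finset.mem_univ, true_and]
    exact fun i => ⟨Finset.mem_union_right _ (Finset.mem_image_of_mem _ (Finset.mem_univ _)),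
      hldr i⟩
  have hTS : T \ Finset.univ.image ldr = S := by
    rw [hT, Finset.union_sdiff_right, Finset.sdiff_eq_self_of_disjoint hS]
  have hcard : ∀ φ : α → V, (∀ i, a (φ i) = i) →
      (Finset.univ.image φ).card = Fintype.card α := by
    intro φ hφ
    rw [Finset.card_image_of_injective _ (Function.LeftInverse.injective hφ), Finset.card_univ]
  have hrest : ∑ φ ∈ (transversals a T).erase ldr,
        multicast a G (T \ Finset.univ.image φ) =
      ∑ φ ∈ (transversals a T).erase ldr, multicast a G' (T \ Finset.univ.image φ) := by
    refine Finset.sum_congr rfl fun φ hφ => h _ ?_ ?_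
    · simp only [Finset.mem_erase, transversals, Finset.mem_filter, Finset.mem_univ,
        true_and] at hφ
      have hsub : Finset.univ.image φ ⊆ T := by
        intro v hv
        obtain ⟨i, -, rfl⟩ := Finset.mem_image.1 hv
        exact (hφ.2 i).1
      rw [Finset.card_sdiff_of_subset hsub, hT, Finset.card_union_of_disjoint hS, hcard _ hldr,
        hcard φ fun i => (hφ.2 i).2]
      omega
    · simp only [Finset.mem_erase, transversals, Finset.mem_filter, Finset.mem_univ,
        true_and] at hφ
      obtain ⟨i, hi⟩ := Function.ne_iff.1 hφ.1
      rw [Finset.not_disjoint_iff]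
      refine ⟨ldr i, ?_, Finset.mem_image_of_mem _ (Finset.mem_univ _)⟩
      rw [Finset.mem_sdiff]
      refine ⟨Finset.mem_union_right _ (Finset.mem_image_of_mem _ (Finset.mem_univ _)), ?_⟩
      intro hv
      obtain ⟨j, -, hj⟩ := Finset.mem_image.1 hv
      have h1 := (hφ.2 j).2
      rw [hj, hldr] at h1
      exact hi (h1 ▸ hj)
  have h0 := sum_multicast_sdiff_transversals a G T
  have h0' := sum_multicast_sdiff_transversals a G' T
  rw [← Finset.add_sum_erase _ _ hmem, hTS] at h0 h0'
  rw [hrest] at h0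
  exact add_right_cancel (h0.trans h0'.symm)

end Multicast

/-! ### The scheme -/

/-- The effective users of a subsystem: one row of `N` users for each user but the sender. -/
abbrev EffUser (n N : ℕ) : Type := Fin n × Fin N

/-- The slots for the bits of a file: a sender, a set of effective users storing the bit, and an
index below `ℓ t`, where `t` is the size of this set. -/
abbrev Slot (n N : ℕ) (ℓ : ℕ → ℕ) : Type :=
  Σ x : Fin (n + 1) × Finset (EffUser n N), Fin (ℓ x.2.card)

/-- A bit as an element of the field with two elements. -/
def bit (b : Bool) : ZMod 2 := if b then 1 else 0

theorem bit_injective : Function.Injective bit := by decide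

variable {n N B : ℕ}

/-- User `k` with secret `s` stores a bit unless it sits in a slot of another sender whose storing
set misses the effective user `(r, s)`, with `r` the row of user `k`. -/
def Stored (ℓ : ℕ → ℕ) (pos : Fin (n + 1) → Finset (EffUser n N) → ℕ → Fin B) (k : Fin (n + 1))
    (s : Fin N) (b : Fin B) : Prop :=
  ∀ j T m, m < ℓ T.card → pos j T m = b → j = k ∨ ∃ r, j.succAbove r = k ∧ (r, s) ∈ T

open Classical in
/-- The library with the bits that are not stored erased. -/
def storedPart (ℓ : ℕ → ℕ) (pos : Fin (n + 1) → Finset (EffUser n N) → ℕ → Fin B)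
    (k : Fin (n + 1)) (s : Fin N) (F : Library N B) : Library N B :=
  fun i b => if Stored ℓ pos k s b then F i b else false

/-- The demand of an effective user in the subsystem of sender `j` for the query `p`. -/
def effDemand [NeZero N] (j : Fin (n + 1)) (p : Fin (n + 1) → Fin N) (u : EffUser n N) : Fin N :=
  p (j.succAbove u.1) + u.2

/-- The multicast messages of sender `j`. -/
def messages [NeZero N] (ℓ : ℕ → ℕ) (pos : Fin (n + 1) → Finset (EffUser n N) → ℕ → Fin B)
    (j : Fin (n + 1)) (p : Fin (n + 1) → Fin N) (F : Library N B) :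
    (Σ S : Finset (EffUser n N), Fin (ℓ (S.card - 1))) → ZMod 2 :=
  fun x => multicast (effDemand j p) (fun i T => bit (F i (pos j T x.2))) x.1

/-- The scheme in which user `k` has a secret shift `s k`, the server broadcasts the shifted demands
`d - s`, and each user serves the effective users of its own subsystem. -/
def virtualUserScheme [NeZero N] (ℓ : ℕ → ℕ)
    (pos : Fin (n + 1) → Finset (EffUser n N) → ℕ → Fin B) : Scheme (n + 1) N B where
  CacheMeta _ := Fin N
  CacheContent _ := Library N B
  PacketMeta _ := Fin (n + 1) → Fin N
  Packet _ := (Σ S : Finset (EffUser n N), Fin (ℓ (S.card - 1))) → ZMod 2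
  placement := PMF.uniformOfFintype (Fin (n + 1) → Fin N)
  cache k s F := storedPart ℓ pos k s F
  query d s := PMF.pure fun _ => d - s
  packet k p z := messages ℓ pos k p z.2

section Scheme

variable {ℓ : ℕ → ℕ} {pos : Fin (n + 1) → Finset (EffUser n N) → ℕ → Fin B}

theorem stored_pos_self
    (hpos : Function.Injective fun x : Slot n N ℓ => pos x.1.1 x.1.2 x.2) (k : Fin (n + 1))
    (s : Fin N) (T : Finset (EffUser n N)) {m : ℕ} (hm : m < ℓ T.card) :
    Stored ℓ pos k s (pos k T m) := by
  intro j T' m' hm' h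
  have := @hpos ⟨(j, T'), ⟨m', hm'⟩⟩ ⟨(k, T), ⟨m, hm⟩⟩ h
  left
  exact congrArg (fun x : Slot n N ℓ => x.1.1) this

theorem stored_pos_of_mem
    (hpos : Function.Injective fun x : Slot n N ℓ => pos x.1.1 x.1.2 x.2) {j k : Fin (n + 1)}
    {r : Fin n} (hr : j.succAbove r = k) {s : Fin N} {T : Finset (EffUser n N)}
    (hs : (r, s) ∈ T) {m : ℕ} (hm : m < ℓ T.card) : Stored ℓ pos k s (pos j T m) := by
  intro j' T' m' hm' h
  have := @hpos ⟨(j', T'), ⟨m', hm'⟩⟩ ⟨(j, T), ⟨m, hm⟩⟩ h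
  have h1 : j' = j := congrArg (fun x : Slot n N ℓ => x.1.1) this
  have h2 : T' = T := congrArg (fun x : Slot n N ℓ => x.1.2) this
  subst h1 h2
  exact Or.inr ⟨r, hr, hs⟩

variable [NeZero N]

/-- The outcome of the scheme for given demands, files and secrets. -/
def outcome (ℓ : ℕ → ℕ) (pos : Fin (n + 1) → Finset (EffUser n N) → ℕ → Fin B)
    (ω : Demands (n + 1) N × Library N B × (Fin (n + 1) → Fin N)) :
    (virtualUserScheme ℓ pos).Outcome :=
  ⟨ω.1, ω.2.1, ω.2.2, fun _ => ω.1 - ω.2.2⟩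

/-- The joint law of demands, files and secrets. -/
def baseLaw (n N B : ℕ) [NeZero N] (PD : PMF (Demands (n + 1) N)) :
    PMF (Demands (n + 1) N × Library N B × (Fin (n + 1) → Fin N)) :=
  PD.bind fun d => (PMF.uniformOfFintype (Library N B)).bind fun F =>
    (PMF.uniformOfFintype (Fin (n + 1) → Fin N)).map fun s => (d, F, s)

/-- The query is deterministic given demands and secrets, so all randomness sits in the triple of
demands, files and secrets. -/
theorem law_eq_map_baseLaw (PD : PMF (Demands (n + 1) N)) :
    (virtualUserScheme ℓ pos).law PD = (baseLaw n N B PD).map (outcome ℓ pos) := by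
  simp only [Scheme.law, baseLaw, PMF.map_bind, PMF.map_comp]
  congr 1; funext d; congr 1; funext F
  simp only [virtualUserScheme, PMF.pure_map]
  rfl

/-- A sender caches its whole share, so its messages can be computed from its cache alone. -/
theorem messages_storedPart
    (hpos : Function.Injective fun x : Slot n N ℓ => pos x.1.1 x.1.2 x.2) (k : Fin (n + 1))
    (s : Fin N) (p : Fin (n + 1) → Fin N) (F : Library N B) :
    messages ℓ pos k p (storedPart ℓ pos k s F) = messages ℓ pos k p F := by
  funext x
  refine Finset.sum_congr rfl fun u hu => ?_
  have := stored_pos_self hpos k s (x.1.erase u) (m := x.2)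
    (by rw [Finset.card_erase_of_mem hu]; exact x.2.2)
  simp only [storedPart, if_pos this]

theorem allX_outcome
    (hpos : Function.Injective fun x : Slot n N ℓ => pos x.1.1 x.1.2 x.2)
    (ω : Demands (n + 1) N × Library N B × (Fin (n + 1) → Fin N)) :
    (virtualUserScheme ℓ pos).allX (outcome ℓ pos ω) =
      fun k => (ω.1 - ω.2.2, messages ℓ pos k (ω.1 - ω.2.2) ω.2.1) := by
  funext k
  exact congrArg (Prod.mk (ω.1 - ω.2.2)) (messages_storedPart hpos k _ _ _)

/-- A user recovers its file from the messages and its cache. -/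
theorem decodable
    (hpos : Function.Injective fun x : Slot n N ℓ => pos x.1.1 x.1.2 x.2) (k : Fin (n + 1))
    (p : Fin (n + 1) → Fin N) (s : Fin N) (F F' : Library N B)
    (hZ : storedPart ℓ pos k s F = storedPart ℓ pos k s F')
    (hX : ∀ j, messages ℓ pos j p F = messages ℓ pos j p F') : F (p k + s) = F' (p k + s) := by
  have hst : ∀ i b, Stored ℓ pos k s b → F i b = F' i b := by
    intro i b hb
    have := congrFun (congrFun hZ i) b
    simpa only [storedPart, if_pos hb] using this
  funext b
  by_cases hb : Stored ℓ pos k s b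
  · exact hst _ b hb
  simp only [Stored, not_forall, not_or, not_exists, not_and] at hb
  -- A missing bit lies in a subfile `T` of another sender `j` with `(r, s) ∉ T`. In the message for
  -- `insert (r, s) T`, every other term comes from a subfile whose set contains `(r, s)`, hence is
  -- cached.
  obtain ⟨j, T, m, hm, rfl, hjk, hT⟩ := hb
  obtain ⟨r, hr⟩ := Fin.exists_succAbove_eq (Ne.symm hjk)
  have hrT := hT r hr
  have hcard : (insert (r, s) T).card - 1 = T.card := by
    rw [Finset.card_insert_of_notMem hrT]; rfl
  have hmsg := congrFun (hX j) ⟨insert (r, s) T, ⟨m, by rw [hcard]; exact hm⟩⟩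
  simp only [messages, multicast] at hmsg
  have hmem : (r, s) ∈ insert (r, s) T := Finset.mem_insert_self _ _
  rw [← Finset.add_sum_erase _ _ hmem, ← Finset.add_sum_erase _ _ hmem] at hmsg
  have hrest : ∀ v ∈ (insert (r, s) T).erase (r, s),
      bit (F (effDemand j p v) (pos j ((insert (r, s) T).erase v) m)) =
        bit (F' (effDemand j p v) (pos j ((insert (r, s) T).erase v) m)) := by
    intro v hv
    rw [Finset.mem_erase] at hv
    rw [hst]
    refine stored_pos_of_mem hpos hr (Finset.mem_erase.2 ⟨hv.1.symm, hmem⟩) ?_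
    rw [Finset.card_erase_of_mem hv.2, hcard]
    exact hm
  rw [Finset.sum_congr rfl hrest] at hmsg
  have := bit_injective (add_right_cancel hmsg)
  rw [Finset.erase_insert hrT] at this
  simpa only [effDemand, hr] using this

theorem condEntropy_files_eq_zero
    (hpos : Function.Injective fun x : Slot n N ℓ => pos x.1.1 x.1.2 x.2)
    (PD : PMF (Demands (n + 1) N)) (k : Fin (n + 1)) :
    condEntropy ((virtualUserScheme ℓ pos).law PD) (fun ω => ω.files (ω.demand k))
      (fun ω => ((virtualUserScheme ℓ pos).allX ω, (virtualUserScheme ℓ pos).Z k ω,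
        ω.demand k)) = 0 := by
  rw [law_eq_map_baseLaw, condEntropy, entropy_map, entropy_map]
  refine condEntropy_eq_zero_of_determined (baseLaw n N B PD) ?_
  rintro ⟨d, F, s⟩ ⟨d', F', s'⟩ h
  have hX := (Prod.ext_iff.1 h).1
  have hs : s k = s' k := (Prod.ext_iff.1 (Prod.ext_iff.1 (Prod.ext_iff.1 h).2).1).1
  have hF : storedPart ℓ pos k (s k) F = storedPart ℓ pos k (s' k) F' :=
    (Prod.ext_iff.1 (Prod.ext_iff.1 (Prod.ext_iff.1 h).2).1).2
  have hd : d k = d' k := (Prod.ext_iff.1 (Prod.ext_iff.1 h).2).2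
  simp only [allX_outcome hpos] at hX
  have hp : d - s = d' - s' := (Prod.ext_iff.1 (congrFun hX k)).1
  rw [← hs] at hF
  have := decodable hpos k (d - s) (s k) F F' hF fun j => by
    have := (Prod.ext_iff.1 (congrFun hX j)).2
    rw [← hp] at this
    exact this
  simp only [outcome, ← hd]
  simpa using this

/-- Given the demands, the view of user `k` has a law that depends only on its own demand. -/
theorem condMutualInfo_demands_eq_zero
    (hpos : Function.Injective fun x : Slot n N ℓ => pos x.1.1 x.1.2 x.2)
    (PD : PMF (Demands (n + 1) N)) (k : Fin (n + 1)) :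
    condMutualInfo ((virtualUserScheme ℓ pos).law PD) (fun ω => ω.demand)
      (fun ω => ((virtualUserScheme ℓ pos).allX ω, (virtualUserScheme ℓ pos).Z k ω))
      (fun ω => ω.demand k) = 0 := by
  have key := condMutualInfo_eq_zero ((virtualUserScheme ℓ pos).law PD) (fun ω => ω.demand)
    (fun ω => ((virtualUserScheme ℓ pos).allX ω, (virtualUserScheme ℓ pos).Z k ω))
    (fun d => d k) PD
    (fun c => (PMF.uniformOfFintype (Library N B)).bind fun F =>
      (PMF.uniformOfFintype (Fin (n + 1) → Fin N)).map fun s =>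
        ((virtualUserScheme ℓ pos).allX (outcome ℓ pos (fun _ => c, F, s)),
          (virtualUserScheme ℓ pos).Z k (outcome ℓ pos (fun _ => c, F, s))))
  refine key ?_
  rw [law_eq_map_baseLaw, PMF.map_comp, baseLaw]
  simp only [PMF.map_bind, PMF.map_comp]
  congr 1; funext d; congr 1; funext F
  -- This shift turns the constant demand `d k` back into the same query `d - s`, and it vanishes at
  -- `k`, so the secret of user `k` is untouched.
  obtain ⟨e, he⟩ : ∃ e : Fin (n + 1) → Fin N, e = (fun _ => d k) - d := ⟨_, rfl⟩
  conv_rhs => rw [← map_uniformOfFintype_equiv (Equiv.addRight e), PMF.map_comp]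
  congr 1; funext s
  simp only [Function.comp_apply, allX_outcome hpos, Equiv.coe_addRight]
  have h1 : (fun _ => d k) - (s + e) = d - s := by rw [he]; abel
  have h2 : (s + e) k = s k := by simp [he]
  have h3 : (virtualUserScheme ℓ pos).Z k (outcome ℓ pos (fun _ => d k, F, s + e)) =
      (virtualUserScheme ℓ pos).Z k (outcome ℓ pos (d, F, s)) := by
    change ((s + e) k, storedPart ℓ pos k ((s + e) k) F) = (s k, storedPart ℓ pos k (s k) F)
    rw [h2]
  rw [h1, h3]
  rfl

end Scheme

/-! ### Cache sizes and loads of the scheme -/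

theorem card_slot (ℓ : ℕ → ℕ) : Fintype.card (Slot n N ℓ) =
    (n + 1) * ∑ t ∈ Finset.range (n * N + 1), (n * N).choose t * ℓ t := by
  have h := Finset.sum_powerset_apply_card ℓ (x := (Finset.univ : Finset (EffUser n N)))
  simp only [Finset.powerset_univ, Finset.card_univ, Fintype.card_prod, Fintype.card_fin,
    smul_eq_mul] at h
  rw [Fintype.card_sigma, Fintype.sum_prod_type]
  simp [h]

theorem exists_injective_slot {ℓ : ℕ → ℕ}
    (h : (n + 1) * ∑ t ∈ Finset.range (n * N + 1), (n * N).choose t * ℓ t ≤ B) (hB : 0 < B) :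
    ∃ pos : Fin (n + 1) → Finset (EffUser n N) → ℕ → Fin B,
      Function.Injective fun x : Slot n N ℓ => pos x.1.1 x.1.2 x.2 := by
  rw [← card_slot] at h
  obtain ⟨e⟩ : Nonempty (Slot n N ℓ ↪ Fin B) :=
    Function.Embedding.nonempty_of_card_le (by rw [Fintype.card_fin]; exact h)
  -- The default value concerns only indices that are not slots.
  refine ⟨fun j T m => if hm : m < ℓ T.card then e ⟨(j, T), ⟨m, hm⟩⟩ else ⟨0, hB⟩, ?_⟩
  convert e.injective using 1
  funext x
  simp

/-- User `k` misses, for each of the `n` other senders, the slots whose set avoids one effective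
user; such sets of size `t` number `C(nN - 1, t)`. These slots inject into the bits not stored. -/
theorem card_stored_add_le {ℓ : ℕ → ℕ} {pos : Fin (n + 1) → Finset (EffUser n N) → ℕ → Fin B}
    (hpos : Function.Injective fun x : Slot n N ℓ => pos x.1.1 x.1.2 x.2) (k : Fin (n + 1))
    (s : Fin N) [DecidablePred (Stored ℓ pos k s)] : Fintype.card {b // Stored ℓ pos k s b} +
      n * ∑ t ∈ Finset.range (n * N - 1 + 1), (n * N - 1).choose t * ℓ t ≤ B := by
  have hrow : ∀ i : Fin n, ∃ r, (k.succAbove i).succAbove r = k := fun i =>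
    Fin.exists_succAbove_eq (Fin.succAbove_ne k i).symm
  choose r hr using hrow
  have hcard : Fintype.card (Σ i : Fin n,
      Σ T : {T : Finset (EffUser n N) // (r i, s) ∉ T}, Fin (ℓ T.1.card)) =
      n * ∑ t ∈ Finset.range (n * N - 1 + 1), (n * N - 1).choose t * ℓ t := by
    rw [Fintype.card_sigma]
    have : ∀ i : Fin n, Fintype.card
        (Σ T : {T : Finset (EffUser n N) // (r i, s) ∉ T}, Fin (ℓ T.1.card)) =
        ∑ t ∈ Finset.range (n * N - 1 + 1), (n * N - 1).choose t * ℓ t := by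
      intro i
      have h := Finset.sum_powerset_apply_card ℓ (x := Finset.univ.erase (r i, s))
      simp only [Finset.card_erase_of_mem (Finset.mem_univ _), Finset.card_univ,
        Fintype.card_prod, Fintype.card_fin, smul_eq_mul] at h
      rw [Fintype.card_sigma, ← h]
      simp only [Fintype.card_fin]
      refine (Finset.sum_subtype _ (fun T => ?_)
        fun T : Finset (EffUser n N) => ℓ T.card).symm
      simp [Finset.subset_erase]
    simp [this]
  have hinj : Fintype.card (Σ i : Fin n,
      Σ T : {T : Finset (EffUser n N) // (r i, s) ∉ T}, Fin (ℓ T.1.card)) ≤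
      Fintype.card {b // ¬ Stored ℓ pos k s b} := by
    refine Fintype.card_le_of_injective
      (fun x => ⟨pos (k.succAbove x.1) x.2.1.1 x.2.2, ?_⟩) ?_
    · intro hst
      rcases hst _ _ _ x.2.2.2 rfl with h | ⟨r', hr', hmem⟩
      · exact Fin.succAbove_ne k x.1 h
      · rw [Fin.succAbove_right_injective (hr'.trans (hr x.1).symm)] at hmem
        exact x.2.1.2 hmem
    · rintro ⟨i, ⟨T, hT⟩, m⟩ ⟨i', ⟨T', hT'⟩, m'⟩ h
      have h1 := @hpos ⟨(k.succAbove i, T), m⟩ ⟨(k.succAbove i', T'), m'⟩ (Subtype.ext_iff.1 h)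
      simp only [Sigma.mk.injEq, Prod.mk.injEq, Fin.succAbove_right_inj] at h1
      obtain ⟨⟨rfl, rfl⟩, h2⟩ := h1
      cases h2
      rfl
  rw [← hcard]
  have := Fintype.card_subtype_compl (fun b => Stored ℓ pos k s b)
  have hle := Fintype.card_subtype_le (fun b => Stored ℓ pos k s b)
  rw [Fintype.card_fin] at this hle
  omega

/-- The cache is determined by the secret, costing `log N`, and by the stored bits of the `N` files,
whose number is bounded uniformly in the secret. -/
theorem entropy_cache_le [NeZero N] {ℓ : ℕ → ℕ}
    {pos : Fin (n + 1) → Finset (EffUser n N) → ℕ → Fin B}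
    (hpos : Function.Injective fun x : Slot n N ℓ => pos x.1.1 x.1.2 x.2)
    (PD : PMF (Demands (n + 1) N)) (k : Fin (n + 1)) :
    entropy ((virtualUserScheme ℓ pos).law PD) ((virtualUserScheme ℓ pos).Z k) ≤
      Real.logb 2 N + N * (B -
        n * ∑ t ∈ Finset.range (n * N - 1 + 1), ((n * N - 1).choose t : ℝ) * ℓ t) := by
  classical
  set c := n * ∑ t ∈ Finset.range (n * N - 1 + 1), (n * N - 1).choose t * ℓ t with hc
  have hN : 0 < N := Nat.pos_of_neZero N
  have hcB : c ≤ B := le_trans (Nat.le_add_left _ _)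
    (card_stored_add_le hpos k (0 : Fin N))
  rw [law_eq_map_baseLaw, entropy_map]
  refine (entropy_le_logb_card_of_determined _
    (β := Σ s : Fin N, (Fin N × {b // Stored ℓ pos k s b} → Bool))
    (fun ω => ⟨ω.2.2 k, fun x => ω.2.1 x.1 x.2.1⟩) ?_).trans ?_
  · rintro ⟨d, F, s⟩ ⟨d', F', s'⟩ h
    simp only [Sigma.mk.injEq] at h
    obtain ⟨hs, hF⟩ := h
    change (s k, storedPart ℓ pos k (s k) F) = (s' k, storedPart ℓ pos k (s' k) F')
    rw [← hs] at hF ⊢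
    refine Prod.ext rfl ?_
    funext i b
    simp only [storedPart]
    split_ifs with hb
    · exact congrFun (eq_of_heq hF) (i, ⟨b, hb⟩)
    · rfl
  · have hle : Fintype.card (Σ s : Fin N, (Fin N × {b // Stored ℓ pos k s b} → Bool)) ≤
        N * 2 ^ (N * (B - c)) := by
      rw [Fintype.card_sigma]
      refine (Finset.sum_le_card_nsmul _ _ (2 ^ (N * (B - c))) fun s _ => ?_).trans (by simp)
      rw [Fintype.card_fun, Fintype.card_prod, Fintype.card_bool, Fintype.card_fin]
      have := card_stored_add_le hpos k s
      exact Nat.pow_le_pow_right (by norm_num) (Nat.mul_le_mul_left _ (by omega))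
    have hpos' : 0 < Fintype.card (Σ s : Fin N, (Fin N × {b // Stored ℓ pos k s b} → Bool)) :=
      Fintype.card_pos_iff.2 ⟨⟨0, fun _ => false⟩⟩
    refine (Real.logb_le_logb_of_le one_lt_two (by exact_mod_cast hpos')
      (Nat.cast_le.2 hle)).trans (le_of_eq ?_)
    push_cast
    rw [Real.logb_mul (by exact_mod_cast hN.ne') (by positivity), Real.logb_pow,
      Real.logb_self_eq_one one_lt_two, Nat.cast_mul, Nat.cast_sub hcB, hc]
    push_cast
    ring

theorem card_multicast_leaders (r₀ : Fin n) (ℓ : ℕ → ℕ) :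
    (Fintype.card (Σ S : {S : Finset (EffUser n N) //
        S ∈ Finset.univ.filter fun S => ¬ Disjoint S (Finset.univ.filter fun u => u.1 = r₀)},
        Fin (ℓ (S.1.card - 1))) : ℝ) =
      ∑ t ∈ Finset.range (n * N + 1),
        (((n * N).choose (t + 1) : ℝ) - ((n * N - N).choose (t + 1) : ℝ)) * ℓ t := by
  classical
  set L : Finset (EffUser n N) := Finset.univ.filter fun u => u.1 = r₀ with hL
  have hLcard : L.card = N := by
    have : L = ({r₀} : Finset (Fin n)) ×ˢ (Finset.univ : Finset (Fin N)) := by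
      ext ⟨r, i⟩; simp [hL, eq_comm]
    rw [this, Finset.card_product]
    simp
  -- The extra `ℓ 0` comes from the empty set, since `0 - 1 = 0` in `ℕ`. It occurs for the full set
  -- and for `Lᶜ`, and cancels in the difference.
  have hsum : ∀ x : Finset (EffUser n N), x.card ≤ n * N →
      ∑ S ∈ x.powerset, (ℓ (S.card - 1) : ℝ) =
        ∑ t ∈ Finset.range (n * N + 1), (x.card.choose (t + 1) : ℝ) * ℓ t + ℓ 0 := by
    intro x hx
    have h1 := Finset.sum_powerset_apply_card (fun c => (ℓ (c - 1) : ℝ)) (x := x)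
    rw [h1, Finset.sum_range_succ']
    simp only [nsmul_eq_mul, Nat.add_sub_cancel, Nat.choose_zero_right, Nat.cast_one, one_mul,
      Nat.zero_sub]
    congr 1
    refine Finset.sum_subset (Finset.range_mono (by omega)) fun t _ ht => ?_
    rw [Finset.mem_range, not_lt] at ht
    rw [Nat.choose_eq_zero_of_lt (by omega)]
    simp
  have hall := hsum Finset.univ (by simp)
  have hcompl := hsum Lᶜ (by rw [Finset.card_compl, hLcard]; simp)
  rw [Finset.card_compl, hLcard] at hcompl
  simp only [Finset.powerset_univ, Finset.card_univ, Fintype.card_prod, Fintype.card_fin]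
    at hall hcompl
  have hdisj : Lᶜ.powerset = Finset.univ.filter fun S => Disjoint S L := by
    ext S
    simp [Finset.subset_compl_iff_disjoint_right]
  rw [hdisj] at hcompl
  rw [Fintype.card_sigma, Nat.cast_sum]
  simp only [Fintype.card_fin]
  rw [Finset.sum_coe_sort (Finset.univ.filter fun S => ¬ Disjoint S L)
    fun S => (ℓ (S.card - 1) : ℝ)]
  have hsplit := Finset.sum_filter_add_sum_filter_not Finset.univ (fun S => Disjoint S L)
    fun S : Finset (EffUser n N) => (ℓ (S.card - 1) : ℝ)
  rw [hall, hcompl] at hsplit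
  simp only [sub_mul, Finset.sum_sub_distrib]
  linarith

/-- Along row `r₀` the demand `p + i` runs once through all files, so this row is a transversal for
every query and the family of needed messages does not depend on `p`. -/
theorem messages_eq_of_eq_on_leaders [NeZero N] {ℓ : ℕ → ℕ}
    {pos : Fin (n + 1) → Finset (EffUser n N) → ℕ → Fin B} (r₀ : Fin n) (j : Fin (n + 1))
    (p : Fin (n + 1) → Fin N) (F F' : Library N B)
    (h : ∀ x : Σ S : Finset (EffUser n N), Fin (ℓ (S.card - 1)),
      ¬ Disjoint x.1 (Finset.univ.filter fun u => u.1 = r₀) →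
        messages ℓ pos j p F x = messages ℓ pos j p F' x) :
    messages ℓ pos j p F = messages ℓ pos j p F' := by
  funext ⟨S, m⟩
  refine multicast_eq_of_eq_on_leaders (effDemand j p)
    (fun i => (r₀, i - p (j.succAbove r₀))) (fun i => by simp [effDemand]) _ _ S ?_
  intro S' hS' hdisj
  have hL : (Finset.univ.image fun i => (r₀, i - p (j.succAbove r₀))) =
      (Finset.univ.filter fun u : EffUser n N => u.1 = r₀) := by
    ext ⟨r, i⟩
    simp only [Finset.mem_image, Finset.mem_univ, true_and, Finset.mem_filter, Prod.mk.injEq]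
    constructor
    · rintro ⟨i', hr, -⟩
      exact hr.symm
    · rintro rfl
      exact ⟨i + p (j.succAbove r), rfl, by simp⟩
  rw [hL] at hdisj
  exact h ⟨S', ⟨m, by rw [hS']; exact m.2⟩⟩ hdisj

/-- The packet contains the redundant messages too, but load is measured by entropy: only the query
and the messages meeting one row count. -/
theorem entropy_signal_le [NeZero N] {ℓ : ℕ → ℕ}
    {pos : Fin (n + 1) → Finset (EffUser n N) → ℕ → Fin B}
    (hpos : Function.Injective fun x : Slot n N ℓ => pos x.1.1 x.1.2 x.2) (hn : 0 < n)
    (PD : PMF (Demands (n + 1) N)) (k : Fin (n + 1)) :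
    entropy ((virtualUserScheme ℓ pos).law PD) ((virtualUserScheme ℓ pos).X k) ≤
      (n + 1) * Real.logb 2 N + ∑ t ∈ Finset.range (n * N + 1),
        (((n * N).choose (t + 1) : ℝ) - ((n * N - N).choose (t + 1) : ℝ)) * ℓ t := by
  classical
  have hN : 0 < N := Nat.pos_of_neZero N
  rw [law_eq_map_baseLaw, entropy_map, ← card_multicast_leaders ⟨0, hn⟩]
  refine (entropy_le_logb_card_of_determined _
    (β := (Fin (n + 1) → Fin N) × ((Σ S : {S : Finset (EffUser n N) //
        S ∈ Finset.univ.filter fun S =>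
          ¬ Disjoint S (Finset.univ.filter fun u => u.1 = (⟨0, hn⟩ : Fin n))},
        Fin (ℓ (S.1.card - 1))) → ZMod 2))
    (fun ω => (ω.1 - ω.2.2,
      fun x => messages ℓ pos k (ω.1 - ω.2.2) ω.2.1 ⟨x.1.1, x.2⟩)) ?_).trans (le_of_eq ?_)
  · rintro ⟨d, F, s⟩ ⟨d', F', s'⟩ h
    simp only [Prod.mk.injEq] at h
    obtain ⟨hp, hF⟩ := h
    have h1 := congrFun (allX_outcome hpos (d, F, s)) k
    have h2 := congrFun (allX_outcome hpos (d', F', s')) k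
    simp only [Scheme.allX] at h1 h2
    rw [h1, h2]
    refine Prod.ext hp ?_
    simp only at hF ⊢
    rw [← hp] at hF ⊢
    refine messages_eq_of_eq_on_leaders ⟨0, hn⟩ k _ _ _ fun x hx => ?_
    exact congrFun hF ⟨⟨x.1, by simpa using hx⟩, x.2⟩
  · rw [Fintype.card_prod, Fintype.card_fun, Fintype.card_fun, ZMod.card, Fintype.card_fin,
      Fintype.card_fin]
    push_cast
    rw [Real.logb_mul (by positivity) (by positivity), Real.logb_pow, Real.logb_pow,
      Real.logb_self_eq_one one_lt_two]
    push_cast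
    ring

/-! ### Memory sharing -/

/-- Memory sharing: `w t` is the fraction of each file split over sets of size `t`, up to rounding.
-/
theorem achievable_of_weights [NeZero N] (hn : 0 < n) (w : ℕ → ℝ)
    (hw : ∀ t ∈ Finset.range (n * N + 1), 0 ≤ w t)
    (hw1 : ∑ t ∈ Finset.range (n * N + 1), w t = 1) :
    Achievable (n + 1) N
      (∑ t ∈ Finset.range (n * N + 1), w t * (((N : ℝ) + t) / (n + 1)))
      (∑ t ∈ Finset.range (n * N + 1), w t *
        ((((n * N).choose (t + 1) : ℝ) - ((n * N - N).choose (t + 1) : ℝ)) /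
          ((n * N).choose t : ℝ))) := by
  have hN : 0 < N := Nat.pos_of_neZero N
  have hU : 0 < n * N := Nat.mul_pos hn hN
  set U := n * N with hUdef
  have hlog : 0 ≤ Real.logb 2 N := Real.logb_nonneg one_lt_two (by exact_mod_cast hN)
  -- `c₁` bounds the excess of a cache: its secret and the bits lost to rounding, which end up
  -- cached. `c₂` counts the queries: `n + 1` signals with `n + 1` shifts each. Rounding down costs
  -- no load.
  set c₁ : ℝ := Real.logb 2 N + ∑ t ∈ Finset.range (U + 1), ((U : ℝ) - t) * (U.choose t : ℝ)
    with hc₁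
  set c₂ : ℝ := (n + 1) * ((n + 1) * Real.logb 2 N) with hc₂
  have hle : ∀ t ∈ Finset.range (U + 1), (t : ℝ) ≤ U := fun t ht => by
    exact_mod_cast Nat.lt_succ_iff.1 (Finset.mem_range.1 ht)
  have hchoose : ∀ t ∈ Finset.range (U + 1), (0 : ℝ) < U.choose t := fun t ht => by
    exact_mod_cast Nat.choose_pos (Nat.lt_succ_iff.1 (Finset.mem_range.1 ht))
  have hc₁0 : 0 ≤ c₁ := add_nonneg hlog <| Finset.sum_nonneg fun t ht =>
    mul_nonneg (sub_nonneg.2 (hle t ht)) (hchoose t ht).le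
  have hc₂0 : 0 ≤ c₂ := by positivity
  refine ⟨fun B => (c₁ + c₂) / B, fun B => by positivity,
    tendsto_const_div_atTop_nhds_zero_nat _, ?_⟩
  filter_upwards [eventually_gt_atTop 0] with B hB
  have hB' : (0 : ℝ) < B := by exact_mod_cast hB
  have hn1 : (0 : ℝ) < n + 1 := by positivity
  -- Each sender's part `w t * B / (n + 1)` is divided evenly among the `C(U, t)` sets. Bits left
  -- over occupy no slot, so every user stores them.
  set ℓ : ℕ → ℕ := fun t => ⌊w t * B / ((n + 1) * U.choose t)⌋₊ with hℓ
  have hℓle : ∀ t ∈ Finset.range (U + 1), (U.choose t : ℝ) * ℓ t ≤ w t * B / (n + 1) := by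
    intro t ht
    have h := Nat.floor_le (a := w t * B / ((n + 1) * U.choose t))
      (by have := hw t ht; positivity)
    have := mul_le_mul_of_nonneg_left h (hchoose t ht).le
    refine this.trans (le_of_eq ?_)
    have := (hchoose t ht).ne'
    field_simp
  have hℓge : ∀ t ∈ Finset.range (U + 1),
      w t * B / (n + 1) - U.choose t ≤ (U.choose t : ℝ) * ℓ t := by
    intro t ht
    have h := (Nat.lt_floor_add_one (w t * B / ((n + 1) * U.choose t))).le
    have h2 := mul_le_mul_of_nonneg_left h (hchoose t ht).le
    have h3 : (U.choose t : ℝ) * (w t * B / ((n + 1) * U.choose t)) = w t * B / (n + 1) := by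
      have := (hchoose t ht).ne'
      field_simp
    rw [h3, mul_add, mul_one] at h2
    linarith
  have hslots : (n + 1) * ∑ t ∈ Finset.range (U + 1), U.choose t * ℓ t ≤ B := by
    have : ((n : ℝ) + 1) * ∑ t ∈ Finset.range (U + 1), (U.choose t : ℝ) * ℓ t ≤ B := by
      calc ((n : ℝ) + 1) * ∑ t ∈ Finset.range (U + 1), (U.choose t : ℝ) * ℓ t
          ≤ (n + 1) * ∑ t ∈ Finset.range (U + 1), w t * B / (n + 1) :=
            mul_le_mul_of_nonneg_left (Finset.sum_le_sum hℓle) hn1.le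
        _ = B := by
            rw [← Finset.sum_div, ← Finset.sum_mul, hw1]
            field_simp
    exact_mod_cast this
  obtain ⟨pos, hpos⟩ := exists_injective_slot hslots hB
  refine ⟨virtualUserScheme ℓ pos, fun PD => ⟨fun k => ?_, fun k => ?_, fun k => ?_, ?_⟩⟩
  · refine (entropy_cache_le hpos PD k).trans ?_
    rw [mul_add, mul_div_cancel₀ _ hB'.ne']
    have hNn : (N : ℝ) * n = U := by rw [hUdef]; push_cast; ring
    -- Uses `U * C(U - 1, t) = (U - t) * C(U, t)`.
    have hsum : (N : ℝ) * (n * ∑ t ∈ Finset.range (U - 1 + 1), ((U - 1).choose t : ℝ) * ℓ t) =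
        ∑ t ∈ Finset.range (U + 1), ((U : ℝ) - t) * ((U.choose t : ℝ) * ℓ t) := by
      rw [← mul_assoc, hNn, Nat.sub_add_cancel hU, Finset.sum_range_succ, sub_self, zero_mul,
        add_zero, Finset.mul_sum]
      refine Finset.sum_congr rfl fun t ht => ?_
      have htU : t ≤ U := (Finset.mem_range.1 ht).le
      have h := Nat.choose_mul_succ_eq (U - 1) t
      rw [Nat.sub_add_cancel hU] at h
      have h' : ((U - 1).choose t : ℝ) * U = U.choose t * ((U : ℝ) - t) := by
        rw [← Nat.cast_sub htU]
        exact_mod_cast h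
      linear_combination (ℓ t : ℝ) * h'
    have hge : ∑ t ∈ Finset.range (U + 1), ((U : ℝ) - t) * (w t * B / (n + 1) - U.choose t) ≤
        ∑ t ∈ Finset.range (U + 1), ((U : ℝ) - t) * ((U.choose t : ℝ) * ℓ t) :=
      Finset.sum_le_sum fun t ht =>
        mul_le_mul_of_nonneg_left (hℓge t ht) (sub_nonneg.2 (hle t ht))
    -- Since `U = n * N`, one has `N - (U - t) / (n + 1) = (N + t) / (n + 1)`.
    have hM : (B : ℝ) * ∑ t ∈ Finset.range (U + 1), w t * (((N : ℝ) + t) / (n + 1)) =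
        N * B - ∑ t ∈ Finset.range (U + 1), ((U : ℝ) - t) * (w t * B / (n + 1)) := by
      have h1 : (N : ℝ) * B = ∑ t ∈ Finset.range (U + 1), w t * (N * B) := by
        rw [← Finset.sum_mul, hw1, one_mul]
      rw [h1, ← Finset.sum_sub_distrib, Finset.mul_sum]
      refine Finset.sum_congr rfl fun t _ => ?_
      rw [← hNn]
      field_simp
      ring
    simp only [mul_sub, Finset.sum_sub_distrib] at hge
    rw [mul_sub, hsum, hM]
    linarith
  · rw [condEntropy_files_eq_zero hpos]
    positivity
  · exact condMutualInfo_demands_eq_zero hpos PD k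
  · refine (Finset.sum_le_sum fun k _ => entropy_signal_le hpos hn PD k).trans ?_
    rw [Finset.sum_const, Finset.card_univ, Fintype.card_fin, nsmul_eq_mul, mul_add (B : ℝ),
      mul_div_cancel₀ _ hB'.ne', mul_add, Nat.cast_add, Nat.cast_one]
    have hsum : ((n : ℝ) + 1) * ∑ t ∈ Finset.range (U + 1),
        ((U.choose (t + 1) : ℝ) - ((U - N).choose (t + 1) : ℝ)) * ℓ t ≤
        B * ∑ t ∈ Finset.range (U + 1), w t *
          (((U.choose (t + 1) : ℝ) - ((U - N).choose (t + 1) : ℝ)) / (U.choose t : ℝ)) := by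
      rw [Finset.mul_sum, Finset.mul_sum]
      refine Finset.sum_le_sum fun t ht => ?_
      have hC := hchoose t ht
      have hmono : 0 ≤ (U.choose (t + 1) : ℝ) - ((U - N).choose (t + 1) : ℝ) :=
        sub_nonneg.2 (by exact_mod_cast Nat.choose_le_choose _ (Nat.sub_le _ _))
      have h := mul_le_mul_of_nonneg_left (hℓle t ht)
        (mul_nonneg hn1.le (div_nonneg hmono hC.le))
      have e1 : ((n : ℝ) + 1) * (((U.choose (t + 1) : ℝ) - ((U - N).choose (t + 1) : ℝ)) /
          U.choose t) * ((U.choose t : ℝ) * ℓ t) =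
          (n + 1) * (((U.choose (t + 1) : ℝ) - ((U - N).choose (t + 1) : ℝ)) * ℓ t) := by
        field_simp
      have e2 : ((n : ℝ) + 1) * (((U.choose (t + 1) : ℝ) - ((U - N).choose (t + 1) : ℝ)) /
          U.choose t) * (w t * B / (n + 1)) =
          B * (w t * (((U.choose (t + 1) : ℝ) - ((U - N).choose (t + 1) : ℝ)) / U.choose t)) := by
        field_simp
      rw [e1, e2] at h
      exact h
    linarith

/-! ### The lower convex envelope -/

theorem cornerPoints_eq_image (K N : ℕ) : cornerPoints K N =
    ((Finset.range (effectiveUsers K N + 1)).image fun t => cornerPoint K N (t + 1) :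
      Finset (ℝ × ℝ)) := by
  ext p
  simp only [cornerPoints, Set.mem_ofPred_eq, Finset.coe_image, Set.mem_image, Finset.mem_coe,
    Finset.mem_range]
  constructor
  · rintro ⟨t, h1, h2, rfl⟩
    exact ⟨t - 1, by omega, by rw [Nat.sub_add_cancel h1]⟩
  · rintro ⟨t, h, rfl⟩
    exact ⟨t + 1, by omega, by omega, rfl⟩

/-- The lower boundary of the convex hull of a finite set belongs to it. -/
theorem lowerConvexEnvelope_mem {S : Set (ℝ × ℝ)} (hS : S.Finite) {x y : ℝ}
    (hxy : (x, y) ∈ convexHull ℝ S) : (x, lowerConvexEnvelope S x) ∈ convexHull ℝ S := by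
  have hcomp : IsCompact (convexHull ℝ S) := hS.isCompact_convexHull (𝕜 := ℝ)
  have hset : {y : ℝ | (x, y) ∈ convexHull ℝ S} =
      Prod.snd '' (convexHull ℝ S ∩ Prod.fst ⁻¹' {x}) := by
    ext z
    constructor
    · exact fun hz => ⟨(x, z), ⟨hz, rfl⟩, rfl⟩
    · rintro ⟨⟨a, b⟩, ⟨h, rfl⟩, rfl⟩
      exact h
  have hc : IsCompact {y : ℝ | (x, y) ∈ convexHull ℝ S} := by
    rw [hset]
    exact (hcomp.inter_right (isClosed_singleton.preimage continuous_fst)).image continuous_snd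
  exact hc.sInf_mem ⟨y, hxy⟩

/-- The parameters `t = 1` and `t = U + 1` have abscissas `N / K` and `N`, so the segment between
these points lies over the whole memory range. Hence the infimum defining the envelope is over a
nonempty set. -/
theorem exists_mem_convexHull_cornerPoints {K N : ℕ} (hK : 2 ≤ K) {M : ℝ}
    (hM : M ∈ Set.Icc ((N : ℝ) / K) (N : ℝ)) :
    ∃ y, (M, y) ∈ convexHull ℝ (cornerPoints K N) := by
  have hK0 : (K : ℝ) ≠ 0 := by
    have : K ≠ 0 := by omega
    exact_mod_cast this
  have h1 : cornerPoint K N 1 ∈ convexHull ℝ (cornerPoints K N) :=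
    subset_convexHull ℝ _ ⟨1, le_rfl, by omega, rfl⟩
  have h2 : cornerPoint K N (effectiveUsers K N + 1) ∈ convexHull ℝ (cornerPoints K N) :=
    subset_convexHull ℝ _ ⟨_, by omega, le_rfl, rfl⟩
  have e1 : (cornerPoint K N 1).1 = (N : ℝ) / K := by simp [cornerPoint]
  have e2 : (cornerPoint K N (effectiveUsers K N + 1)).1 = N := by
    simp only [cornerPoint, effectiveUsers]
    rw [div_eq_iff hK0]
    push_cast [Nat.cast_sub (show 1 ≤ K by omega)]
    ring
  rw [← segment_eq_Icc (hM.1.trans hM.2)] at hM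
  obtain ⟨a, b, ha, hb, hab, hx⟩ := hM
  have := convex_convexHull ℝ (cornerPoints K N) h1 h2 ha hb hab
  refine ⟨(a • cornerPoint K N 1 + b • cornerPoint K N (effectiveUsers K N + 1)).2, ?_⟩
  convert this using 1
  refine Prod.ext ?_ rfl
  simp only [Prod.fst_add, Prod.smul_fst, e1, e2, hx]

theorem achievable_of_mem_convexHull {K N : ℕ} (hK : 2 ≤ K) (hN : 0 < N) {M R : ℝ}
    (h : (M, R) ∈ convexHull ℝ (cornerPoints K N)) : Achievable K N M R := by
  obtain ⟨n, rfl⟩ : ∃ n, K = n + 1 := ⟨K - 1, by omega⟩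
  have : NeZero N := ⟨hN.ne'⟩
  have hU : effectiveUsers (n + 1) N = n * N := by simp [effectiveUsers]
  have hn1 : ((n : ℝ) + 1) ≠ 0 := by positivity
  -- Distinct parameters have distinct abscissas, so weights on the set of points can be reindexed
  -- by `t`.
  have hinj : Function.Injective fun t => cornerPoint (n + 1) N (t + 1) := by
    intro t t' ht
    have := (Prod.ext_iff.1 ht).1
    simp only [cornerPoint] at this
    push_cast at this
    rw [div_left_inj' hn1] at this
    have h' : (t : ℝ) = t' := by linarith
    exact_mod_cast h'
  rw [cornerPoints_eq_image, Finset.convexHull_eq] at h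
  obtain ⟨w, hw0, hw1, hw⟩ := h
  rw [Finset.centerMass_eq_of_sum_1 _ _ hw1, Finset.sum_image hinj.injOn] at hw
  rw [Finset.sum_image hinj.injOn] at hw1
  rw [hU] at hw0 hw1 hw
  have hach := achievable_of_weights (N := N) (show 0 < n by omega)
    (fun t => w (cornerPoint (n + 1) N (t + 1)))
    (fun t ht => hw0 _ (Finset.mem_image_of_mem _ ht)) hw1
  have hM := congrArg Prod.fst hw
  have hR := congrArg Prod.snd hw
  simp only [Prod.fst_sum, Prod.snd_sum, id, Prod.smul_fst, Prod.smul_snd, smul_eq_mul] at hM hR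
  rw [← hM, ← hR]
  convert hach using 1
  · refine Finset.sum_congr rfl fun t _ => ?_
    congr 1
    simp only [cornerPoint]
    push_cast
    ring
  · refine Finset.sum_congr rfl fun t _ => ?_
    congr 1

end D2DCaching

end

theorem theorem2 (K N : ℕ) (hK : 2 ≤ K) (hN : 2 ≤ N) (M : ℝ)
    (hM : M ∈ Set.Icc ((N : ℝ) / K) (N : ℝ)) :
    D2DCaching.Achievable K N M
        (D2DCaching.lowerConvexEnvelope (D2DCaching.cornerPoints K N) M) ∧
      D2DCaching.optimalLoad K N M ≤
        D2DCaching.lowerConvexEnvelope (D2DCaching.cornerPoints K N) M := by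
  obtain ⟨y, hy⟩ := D2DCaching.exists_mem_convexHull_cornerPoints hK hM
  have hfin : (D2DCaching.cornerPoints K N).Finite := by
    rw [D2DCaching.cornerPoints_eq_image]
    exact Finset.finite_toSet _
  have hach := D2DCaching.achievable_of_mem_convexHull hK (by omega)
    (D2DCaching.lowerConvexEnvelope_mem hfin hy)
  exact ⟨hach, csInf_le (D2DCaching.bddBelow_achievable (by omega) M) hach⟩
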